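/- Let $0<q<1$ and let $\mathcal A$ be the coordinate $*$-algebra of the quantum group $SU_q(2)$: the unital complex algebra generated by $a,b,c,d$ with $ab=q\,ba$, $ac=q\,ca$, $bd=q\,db$, $cd=q\,dc$, $bc=cb$, $ad-q\,bc=da-q^{-1}bc=1$ and involution $a^*=d$, $b^*=-qc$, $c^*=-q^{-1}b$, $d^*=a$. Let $h$ be its Haar state, and let $L^2(SU_q(2))$ be the completion of $\mathcal A$ for $\langle y,x\rangle=h(xy^*)$, $\|f\|^2=h(ff^*)$; right multiplication by an element of $\mathcal A$ extends to a bounded operator on $L^2(SU_q(2))$. For $l\in\frac12\mathbb N=\{0,\frac12,1,\dots\}$ put $I_{2l+1}=\{-l,-l+1,\dots,l\}$ and let $T^l=(t^l_{ij})_{i,j\in I_{2l+1}}$ be the matrix, in the orthonormal basis $\left[{2l\atop l+j}\right]_{q^{-2}}^{1/2}x^{l-j}y^{l+j}$ ($j\in I_{2l+1}$; Gaussian binomials), of the irreducible corepresentation of $SU_q(2)$ on the homogeneous polynomials of degree $2l$ in the quantum plane $xy=q\,yx$, where $R(x)=x\otimes a+y\otimes c$ and $R(y)=x\otimes b+y\otimes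 d$. Put $[n]_q=\frac{q^n-q^{-n}}{q-q^{-1}}$. The Fourier transform of $f\in L^2(SU_q(2))$ is $\hat f(l)_{mn}=h\big(f(t^l_{nm})^*\big)=\langle t^l_{nm},f\rangle$. A symbol is a function $\sigma$ assigning to each $l\in\frac12\mathbb N$ a $(2l+1)\times(2l+1)$ matrix $\sigma(l)$ with entries in $L^2(SU_q(2))$. Its global pseudo-differential operator is $$T_\sigma f=\sum_{l\in\frac12\mathbb N}[2l+1]_q\,\mathrm{Tr}\big(\sigma(l)\hat f(l)T^l\big)=\sum_{l\in\frac12\mathbb N}[2l+1]_q\sum_{i,j,p\in I_{2l+1}}\hat f(l)_{jp}\,\sigma(l)_{ij}\,t^l_{pi},$$ defined for those $f\in L^2(SU_q(2))$ for which the partial sums (over $l\le L$, $L\to\infty$) converge in norm. For $m\in\frac12\mathbb N$, a symbol $\sigma$ is homogeneous of Fourier order $m$ if for every $l$ there is a map $\psi_\sigma(l)$ from $I_{2l+1}\times I_{2l+1}$ to pairs of half-integers such that $\sigma(l)_{ij}\in\mathrm{Span}\{t^m_{\psi_\sigma(l)(i,j)}\}$ if $\psi_\sigma(l)(i,j)\in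 I_{2m+1}\times I_{2m+1}$, and $\sigma(l)_{ij}=0$ otherwise. For $m\in\frac12\mathbb N$, $m>0$, a symbol $\sigma$ is homogeneous of Fourier order $-m$ if there is a homogeneous symbol $\beta$ of Fourier order $m$ such that $T_\beta T_\sigma f=T_\sigma T_\beta f=f$ (all expressions being defined) for every $f\in\mathcal A$. For $m\in\frac12\mathbb Z$, $\Phi^m(SU_q(2))$ is the set of finite complex linear combinations of homogeneous symbols of Fourier order $m$. **Corollary.** Let $m\in\frac12\mathbb Z$ and let $\sigma\in\Phi^m(SU_q(2))$ be such that, for some $N\in\mathbb N$, $\sigma(l)=0$ for all $l>N$. Then $T_\sigma$ is of finite rank: it is defined on all of $L^2(SU_q(2))$, it is continuous, and its range is finite dimensional. -/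

import Mathlib

open scoped TensorProduct

noncomputable section

/-- The range `0 < q < 1` of the deformation parameter. -/
abbrev QParam : Type := Set.Ioo (0 : ℝ) 1

/-- The real parameter `q`, regarded as a complex scalar. -/
def QParam.toC (q : QParam) : ℂ := ((q : ℝ) : ℂ)

lemma QParam.pos (q : QParam) : 0 < (q : ℝ) := q.2.1

lemma QParam.lt_one (q : QParam) : (q : ℝ) < 1 := q.2.2

lemma QParam.toC_ne_zero (q : QParam) : q.toC ≠ 0 := by
  simpa [QParam.toC] using q.pos.ne'

lemma QParam.star_toC (q : QParam) : star q.toC = q.toC := by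
  simp [QParam.toC]

/-! ### The coordinate `*`-algebra of `SU_q(2)` -/

/-- The defining relations of the coordinate algebra of `SU_q(2)`. -/
structure QSU2Rel {B : Type*} [Ring B] [Algebra ℂ B] (q : QParam) (a b c d : B) : Prop where
  ab : a * b = q.toC • (b * a)
  ac : a * c = q.toC • (c * a)
  bd : b * d = q.toC • (d * b)
  cd : c * d = q.toC • (d * c)
  bc : b * c = c * b
  ad : a * d - q.toC • (b * c) = 1
  da : d * a - q.toC⁻¹ • (b * c) = 1

/-- Names of the four generators. -/
inductive QSU2Gen : Type
  | a | b | c | d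

/-- The defining relations, as a relation on the free algebra on four generators. -/
inductive QSU2FreeRel (q : QParam) :
    FreeAlgebra ℂ QSU2Gen → FreeAlgebra ℂ QSU2Gen → Prop
  | ab : QSU2FreeRel q (.ι ℂ .a * .ι ℂ .b) (q.toC • (.ι ℂ .b * .ι ℂ .a))
  | ac : QSU2FreeRel q (.ι ℂ .a * .ι ℂ .c) (q.toC • (.ι ℂ .c * .ι ℂ .a))
  | bd : QSU2FreeRel q (.ι ℂ .b * .ι ℂ .d) (q.toC • (.ι ℂ .d * .ι ℂ .b))
  | cd : QSU2FreeRel q (.ι ℂ .c * .ι ℂ .d) (q.toC • (.ι ℂ .d * .ι ℂ .c))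
  | bc : QSU2FreeRel q (.ι ℂ .b * .ι ℂ .c) (.ι ℂ .c * .ι ℂ .b)
  | ad : QSU2FreeRel q (.ι ℂ .a * .ι ℂ .d - q.toC • (.ι ℂ .b * .ι ℂ .c)) 1
  | da : QSU2FreeRel q (.ι ℂ .d * .ι ℂ .a - q.toC⁻¹ • (.ι ℂ .b * .ι ℂ .c)) 1

/-- The coordinate algebra of `SU_q(2)`: the unital complex algebra on `a, b, c, d` subject to the
defining relations. -/
def QSU2 (q : QParam) : Type := RingQuot (QSU2FreeRel q)

namespace QSU2

instance (q : QParam) : Ring (QSU2 q) := inferInstanceAs (Ring (RingQuot (QSU2FreeRel q)))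

instance (q : QParam) : Algebra ℂ (QSU2 q) :=
  inferInstanceAs (Algebra ℂ (RingQuot (QSU2FreeRel q)))

/-- The projection from the free algebra. -/
def mk (q : QParam) : FreeAlgebra ℂ QSU2Gen →ₐ[ℂ] QSU2 q := RingQuot.mkAlgHom ℂ (QSU2FreeRel q)

/-- The generators. -/
def gen (q : QParam) (g : QSU2Gen) : QSU2 q := mk q (.ι ℂ g)

lemma mk_surjective (q : QParam) : Function.Surjective (mk q) :=
  RingQuot.mkAlgHom_surjective ℂ _

lemma mk_rel {q : QParam} {x y : FreeAlgebra ℂ QSU2Gen} (h : QSU2FreeRel q x y) :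
    mk q x = mk q y :=
  RingQuot.mkAlgHom_rel ℂ h

lemma gen_rel (q : QParam) : QSU2Rel q (gen q .a) (gen q .b) (gen q .c) (gen q .d) where
  ab := by simpa [gen] using mk_rel (QSU2FreeRel.ab (q := q))
  ac := by simpa [gen] using mk_rel (QSU2FreeRel.ac (q := q))
  bd := by simpa [gen] using mk_rel (QSU2FreeRel.bd (q := q))
  cd := by simpa [gen] using mk_rel (QSU2FreeRel.cd (q := q))
  bc := by simpa [gen] using mk_rel (QSU2FreeRel.bc (q := q))
  ad := by simpa [gen] using mk_rel (QSU2FreeRel.ad (q := q))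
  da := by simpa [gen] using mk_rel (QSU2FreeRel.da (q := q))

/-- Send the generators `a, b, c, d` to four given elements. -/
def genMap {B : Type*} (a b c d : B) : QSU2Gen → B
  | .a => a
  | .b => b
  | .c => c
  | .d => d

/-- The universal property of the coordinate algebra. -/
def lift {q : QParam} {B : Type*} [Ring B] [Algebra ℂ B] {a b c d : B}
    (h : QSU2Rel q a b c d) : QSU2 q →ₐ[ℂ] B :=
  RingQuot.liftAlgHom ℂ ⟨FreeAlgebra.lift ℂ (genMap a b c d), by
    intro x y hxy
    cases hxy <;> simp [genMap, h.ab, h.ac, h.bd, h.cd, h.bc]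
    · exact h.bc ▸ h.ad
    · exact h.bc ▸ h.da⟩

lemma lift_gen {q : QParam} {B : Type*} [Ring B] [Algebra ℂ B] {a b c d : B}
    (h : QSU2Rel q a b c d) (g : QSU2Gen) : lift h (gen q g) = genMap a b c d g :=
  (RingQuot.liftAlgHom_mkAlgHom_apply ℂ _ _ _).trans (FreeAlgebra.lift_ι_apply _ _)

@[elab_as_elim]
lemma induction {q : QParam} {P : QSU2 q → Prop} (scalar : ∀ z : ℂ, P (algebraMap ℂ _ z))
    (gens : ∀ g, P (gen q g)) (mul : ∀ x y, P x → P y → P (x * y))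
    (add : ∀ x y, P x → P y → P (x + y)) (x : QSU2 q) : P x := by
  obtain ⟨x, rfl⟩ := mk_surjective q x
  induction x with
  | grade0 z => simpa using scalar z
  | grade1 g => exact gens g
  | mul x y hx hy => simpa using mul _ _ hx hy
  | add x y hx hy => simpa using add _ _ hx hy

end QSU2

/-- The opposite algebra with complex conjugate scalars; algebra homomorphisms into it are
conjugate-linear antihomomorphisms. -/
def ConjOp (B : Type*) : Type _ := Bᵐᵒᵖ

namespace ConjOp

instance (B : Type*) [Ring B] : Ring (ConjOp B) := inferInstanceAs (Ring Bᵐᵒᵖ)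

instance (B : Type*) [Ring B] [Algebra ℂ B] : Algebra ℂ (ConjOp B) :=
  RingHom.toAlgebra' ((algebraMap ℂ Bᵐᵒᵖ).comp (starRingEnd ℂ)) fun z x =>
    Algebra.commutes (A := Bᵐᵒᵖ) (starRingEnd ℂ z) x

def op {B : Type*} (x : B) : ConjOp B := MulOpposite.op x

def unop {B : Type*} (x : ConjOp B) : B := MulOpposite.unop x

@[simp] lemma unop_op {B : Type*} (x : B) : (op x).unop = x := rfl

lemma op_mul {B : Type*} [Ring B] (x y : B) : op x * op y = op (y * x) := rfl

lemma op_sub {B : Type*} [Ring B] (x y : B) : op x - op y = op (x - y) := rfl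

lemma op_one {B : Type*} [Ring B] : op (1 : B) = 1 := rfl

lemma unop_mul {B : Type*} [Ring B] (x y : ConjOp B) : (x * y).unop = y.unop * x.unop := rfl

lemma unop_add {B : Type*} [Ring B] (x y : ConjOp B) : (x + y).unop = x.unop + y.unop := rfl

lemma unop_algebraMap {B : Type*} [Ring B] [Algebra ℂ B] (z : ℂ) :
    (algebraMap ℂ (ConjOp B) z).unop = algebraMap ℂ B (star z) := rfl

lemma smul_op {B : Type*} [Ring B] [Algebra ℂ B] (z : ℂ) (x : B) : z • op x = op (star z • x) := by
  rw [Algebra.smul_def]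
  change MulOpposite.op (x * algebraMap ℂ B (star z)) = MulOpposite.op (star z • x)
  rw [Algebra.smul_def, Algebra.commutes]

end ConjOp

namespace QSU2

open ConjOp in
lemma star_rel (q : QParam) : QSU2Rel q (op (gen q .d)) (op (-q.toC • gen q .c))
    (op (-q.toC⁻¹ • gen q .b)) (op (gen q .a)) := by
  have h := gen_rel q
  have hq := q.toC_ne_zero
  have hs : star q.toC⁻¹ = q.toC⁻¹ := by rw [star_inv₀, q.star_toC]
  constructor <;> simp only [op_mul, smul_op, op_sub, q.star_toC, hs, ← op_one] <;>
    congr 1 <;> simp [h.ab, h.ac, h.bd, h.cd, smul_smul, hq]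
  · rw [h.bc]
  · exact h.bc ▸ h.ad
  · exact h.bc ▸ h.da

/-- The involution as an algebra homomorphism into the conjugate opposite algebra. It is determined
by `a* = d`, `b* = -q c`, `c* = -q⁻¹ b`, `d* = a`. -/
def starHom (q : QParam) : QSU2 q →ₐ[ℂ] ConjOp (QSU2 q) := lift (star_rel q)

instance (q : QParam) : Star (QSU2 q) := ⟨fun x => (starHom q x).unop⟩

lemma star_def {q : QParam} (x : QSU2 q) : star x = (starHom q x).unop := rfl

lemma star_mul' {q : QParam} (x y : QSU2 q) : star (x * y) = star y * star x := by
  simp [star_def, ConjOp.unop_mul]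

lemma star_add' {q : QParam} (x y : QSU2 q) : star (x + y) = star x + star y := by
  simp [star_def, ConjOp.unop_add]

lemma star_algebraMap' {q : QParam} (z : ℂ) :
    star (algebraMap ℂ (QSU2 q) z) = algebraMap ℂ _ (star z) := by
  rw [star_def, AlgHom.commutes, ConjOp.unop_algebraMap]

lemma star_smul' {q : QParam} (z : ℂ) (x : QSU2 q) : star (z • x) = star z • star x := by
  rw [Algebra.smul_def, star_mul', star_algebraMap', ← Algebra.commutes, Algebra.smul_def]

lemma star_a (q : QParam) : star (gen q .a) = gen q .d := by
  simp [star_def, starHom, lift_gen, genMap]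

lemma star_b (q : QParam) : star (gen q .b) = -q.toC • gen q .c := by
  simp [star_def, starHom, lift_gen, genMap]

lemma star_c (q : QParam) : star (gen q .c) = -q.toC⁻¹ • gen q .b := by
  simp [star_def, starHom, lift_gen, genMap]

lemma star_d (q : QParam) : star (gen q .d) = gen q .a := by
  simp [star_def, starHom, lift_gen, genMap]

instance (q : QParam) : StarRing (QSU2 q) where
  star_involutive x := by
    have hq := q.toC_ne_zero
    induction x using QSU2.induction with
    | scalar z => simp [star_algebraMap']
    | gens g =>
      have hs : star (-q.toC) = -q.toC := by rw [star_neg, q.star_toC]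
      have hs' : star (-q.toC⁻¹) = -q.toC⁻¹ := by rw [star_neg, star_inv₀, q.star_toC]
      cases g <;> simp only [star_a, star_b, star_c, star_d, star_smul', hs, hs', smul_smul] <;>
        simp [hq]
    | mul x y hx hy => simp [star_mul', hx, hy]
    | add x y hx hy => simp [star_add', hx, hy]
  star_mul := star_mul'
  star_add := star_add'

instance (q : QParam) : StarModule ℂ (QSU2 q) := ⟨star_smul'⟩

end QSU2

/-! ### Woronowicz's representation and the Haar state -/

/-- For a weight `w` bounded by one and a map `φ` that is injective where `w` does not vanish,
`f ↦ w • (f ∘ φ)` is a contraction of `ℓ²(X)`. -/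
lemma summable_weighted {X : Type*} {w : X → ℂ} {φ : X → X} (hw : ∀ x, ‖w x‖ ≤ 1)
    (hφ : Set.InjOn φ {x | w x ≠ 0}) (f : lp (fun _ : X => ℂ) 2) (s : Finset X) :
    ∑ x ∈ s, ‖w x * f (φ x)‖ ^ (2 : ENNReal).toReal ≤ ‖f‖ ^ (2 : ENNReal).toReal := by
  classical
  have h2 : 0 < (2 : ENNReal).toReal := by norm_num
  calc ∑ x ∈ s, ‖w x * f (φ x)‖ ^ (2 : ENNReal).toReal
      = ∑ x ∈ s with w x ≠ 0, ‖w x * f (φ x)‖ ^ (2 : ENNReal).toReal := by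
        refine (Finset.sum_filter_of_ne (p := fun x => w x ≠ 0) fun x _ hx h0 => hx ?_).symm
        simp [h0]
    _ ≤ ∑ x ∈ s with w x ≠ 0, ‖f (φ x)‖ ^ (2 : ENNReal).toReal := by
        refine Finset.sum_le_sum fun x _ => Real.rpow_le_rpow (norm_nonneg _) ?_ h2.le
        rw [norm_mul]
        exact mul_le_of_le_one_left (norm_nonneg _) (hw x)
    _ = ∑ y ∈ (s.filter (w · ≠ 0)).image φ, ‖f y‖ ^ (2 : ENNReal).toReal := by
        rw [Finset.sum_image]
        intro x hx y hy h
        exact hφ (by simpa using (Finset.mem_filter.1 hx).2)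
          (by simpa using (Finset.mem_filter.1 hy).2) h
    _ ≤ ‖f‖ ^ (2 : ENNReal).toReal := lp.sum_rpow_le_norm_rpow h2 f _

/-- The operator `(W f)(x) = w(x) f(φ(x))` on `ℓ²(X)`. -/
def weightedComp {X : Type*} (w : X → ℂ) (φ : X → X) (hw : ∀ x, ‖w x‖ ≤ 1)
    (hφ : Set.InjOn φ {x | w x ≠ 0}) : lp (fun _ : X => ℂ) 2 →L[ℂ] lp (fun _ : X => ℂ) 2 :=
  LinearMap.mkContinuous
    { toFun := fun f => ⟨fun x => w x * f (φ x), memℓp_gen' (summable_weighted hw hφ f)⟩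
      map_add' := fun f g => by ext x; exact mul_add (w x) (f (φ x)) (g (φ x))
      map_smul' := fun z f => by ext x; exact mul_left_comm (w x) z (f (φ x)) } 1 fun f => by
    rw [one_mul]
    exact lp.norm_le_of_forall_sum_le (by norm_num) (norm_nonneg f) (summable_weighted hw hφ f)

lemma weightedComp_apply {X : Type*} (w : X → ℂ) (φ : X → X) (hw : ∀ x, ‖w x‖ ≤ 1)
    (hφ : Set.InjOn φ {x | w x ≠ 0}) (f : lp (fun _ : X => ℂ) 2) (x : X) :
    weightedComp w φ hw hφ f x = w x * f (φ x) := rfl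

namespace QSU2

/-- The Hilbert space `ℓ²(ℤ × ℕ)`. -/
abbrev L2 : Type := lp (fun _ : ℤ × ℕ => ℂ) 2

/-- The standard orthonormal basis `e k n` of `ℓ²(ℤ × ℕ)`. -/
def e (k : ℤ) (n : ℕ) : L2 := lp.single 2 (k, n) (1 : ℂ)

/-- The number `√(1 - q^{2n})`. -/
def wt (q : QParam) (n : ℕ) : ℝ := √(1 - (q : ℝ) ^ (2 * n))

lemma wt_sq (q : QParam) (n : ℕ) : (wt q n : ℂ) * wt q n = 1 - q.toC ^ (2 * n) := by
  have h : (q : ℝ) ^ (2 * n) ≤ 1 := pow_le_one₀ q.pos.le q.lt_one.le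
  have := Real.mul_self_sqrt (sub_nonneg.2 h)
  rw [wt, ← Complex.ofReal_mul, this]
  simp [QParam.toC]

lemma norm_wt_le (q : QParam) (n : ℕ) : ‖(wt q n : ℂ)‖ ≤ 1 := by
  rw [Complex.norm_real, wt, Real.norm_of_nonneg (Real.sqrt_nonneg _),
    Real.sqrt_le_left zero_le_one]
  have : 0 ≤ (q : ℝ) ^ (2 * n) := pow_nonneg q.pos.le _
  linarith

lemma wt_zero (q : QParam) : wt q 0 = 0 := by simp [wt]

lemma norm_pow_le (q : QParam) (n : ℕ) : ‖q.toC ^ n‖ ≤ 1 := by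
  rw [norm_pow, QParam.toC, Complex.norm_real, Real.norm_of_nonneg q.pos.le]
  exact pow_le_one₀ q.pos.le q.lt_one.le

/-- The operator `a e_{k,n} = √(1 - q^{2n}) e_{k,n-1}`, where `a e_{k,0} = 0`. -/
def opA (q : QParam) : L2 →L[ℂ] L2 :=
  weightedComp (fun x => wt q (x.2 + 1)) (fun x => (x.1, x.2 + 1)) (fun _ => norm_wt_le q _)
    (by rintro ⟨k, n⟩ - ⟨l, m⟩ - h; simpa using h)

/-- The adjoint `a* e_{k,n} = √(1 - q^{2n+2}) e_{k,n+1}`. -/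
def opAStar (q : QParam) : L2 →L[ℂ] L2 :=
  weightedComp (fun x => wt q x.2) (fun x => (x.1, x.2 - 1)) (fun _ => norm_wt_le q _) (by
    rintro ⟨k, n⟩ hn ⟨l, m⟩ hm h
    have hn' : n ≠ 0 := fun h => hn (by simp [h, wt_zero])
    have hm' : m ≠ 0 := fun h => hm (by simp [h, wt_zero])
    simp only [Prod.mk.injEq] at h ⊢
    omega)

/-- The operator `c e_{k,n} = q^n e_{k+1,n}`. -/
def opC (q : QParam) : L2 →L[ℂ] L2 :=
  weightedComp (fun x => q.toC ^ x.2) (fun x => (x.1 - 1, x.2)) (fun _ => norm_pow_le q _)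
    (by rintro ⟨k, n⟩ - ⟨l, m⟩ - h; simpa using h)

/-- The adjoint `c* e_{k,n} = q^n e_{k-1,n}`. -/
def opCStar (q : QParam) : L2 →L[ℂ] L2 :=
  weightedComp (fun x => q.toC ^ x.2) (fun x => (x.1 + 1, x.2)) (fun _ => norm_pow_le q _)
    (by rintro ⟨k, n⟩ - ⟨l, m⟩ - h; simpa using h)

lemma e_apply (k l : ℤ) (n m : ℕ) : e k n (l, m) = if l = k ∧ m = n then (1 : ℂ) else 0 := by
  simp [e, Pi.single_apply]

lemma opA_apply (q : QParam) (f : L2) (k : ℤ) (n : ℕ) :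
    opA q f (k, n) = wt q (n + 1) * f (k, n + 1) := rfl

lemma opAStar_apply (q : QParam) (f : L2) (k : ℤ) (n : ℕ) :
    opAStar q f (k, n) = wt q n * f (k, n - 1) := rfl

lemma opC_apply (q : QParam) (f : L2) (k : ℤ) (n : ℕ) :
    opC q f (k, n) = q.toC ^ n * f (k - 1, n) := rfl

lemma opCStar_apply (q : QParam) (f : L2) (k : ℤ) (n : ℕ) :
    opCStar q f (k, n) = q.toC ^ n * f (k + 1, n) := rfl

lemma opA_e_zero (q : QParam) (k : ℤ) : opA q (e k 0) = 0 := by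
  ext ⟨l, m⟩
  simp [opA_apply, e_apply]

lemma opA_e_succ (q : QParam) (k : ℤ) (n : ℕ) :
    opA q (e k (n + 1)) = (wt q (n + 1) : ℂ) • e k n := by
  ext ⟨l, m⟩
  rw [opA_apply, lp.coeFn_smul, Pi.smul_apply, e_apply, e_apply]
  by_cases h : l = k ∧ m = n
  · simp [h]
  · simp [h]

lemma opC_e (q : QParam) (k : ℤ) (n : ℕ) : opC q (e k n) = q.toC ^ n • e (k + 1) n := by
  ext ⟨l, m⟩
  rw [opC_apply, lp.coeFn_smul, Pi.smul_apply, e_apply, e_apply]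
  simp only [sub_eq_iff_eq_add]
  by_cases h : l = k + 1 ∧ m = n
  · simp [h]
  · simp [h]

lemma apply_eq_inner (f : L2) (k : ℤ) (n : ℕ) : f (k, n) = inner ℂ (e k n) f := by
  simp [e, lp.inner_single_left]

open ContinuousLinearMap in
lemma adjoint_opA (q : QParam) : adjoint (opA q) = opAStar q := by
  ext f ⟨k, n⟩
  rw [apply_eq_inner, adjoint_inner_right, opAStar_apply]
  cases n with
  | zero => simp [opA_e_zero, wt_zero]
  | succ n => rw [opA_e_succ, inner_smul_left, apply_eq_inner]; simp

open ContinuousLinearMap in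
lemma adjoint_opC (q : QParam) : adjoint (opC q) = opCStar q := by
  ext f ⟨k, n⟩
  have h : star (q.toC ^ n) = q.toC ^ n := by rw [star_pow, q.star_toC]
  rw [apply_eq_inner, adjoint_inner_right, opCStar_apply, opC_e, inner_smul_left, apply_eq_inner]
  exact congrArg (· * _) h

lemma op_rel (q : QParam) :
    QSU2Rel q (opA q) (-q.toC • opCStar q) (opC q) (opAStar q) := by
  have hq := q.toC_ne_zero
  constructor <;> ext f ⟨k, n⟩
  · change wt q (n + 1) * (-q.toC * (q.toC ^ (n + 1) * f (k + 1, n + 1)))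
      = q.toC * (-q.toC * (q.toC ^ n * (wt q (n + 1) * f (k + 1, n + 1))))
    ring
  · change wt q (n + 1) * (q.toC ^ (n + 1) * f (k - 1, n + 1))
      = q.toC * (q.toC ^ n * (wt q (n + 1) * f (k - 1, n + 1)))
    ring
  · change -q.toC * (q.toC ^ n * (wt q n * f (k + 1, n - 1)))
      = q.toC * (wt q n * (-q.toC * (q.toC ^ (n - 1) * f (k + 1, n - 1))))
    cases n with
    | zero => simp [wt_zero]
    | succ n => rw [Nat.add_sub_cancel]; ring
  · change q.toC ^ n * (wt q n * f (k - 1, n - 1))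
      = q.toC * (wt q n * (q.toC ^ (n - 1) * f (k - 1, n - 1)))
    cases n with
    | zero => simp [wt_zero]
    | succ n => rw [Nat.add_sub_cancel]; ring
  · change -q.toC * (q.toC ^ n * (q.toC ^ n * f (k + 1 - 1, n)))
      = q.toC ^ n * (-q.toC * (q.toC ^ n * f (k - 1 + 1, n)))
    rw [add_sub_cancel_right, sub_add_cancel]; ring
  · change wt q (n + 1) * (wt q (n + 1) * f (k, n + 1 - 1))
      - q.toC * (-q.toC * (q.toC ^ n * (q.toC ^ n * f (k + 1 - 1, n)))) = f (k, n)
    rw [add_sub_cancel_right, Nat.add_sub_cancel, ← mul_assoc, wt_sq]; ring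
  · change wt q n * (wt q (n - 1 + 1) * f (k, n - 1 + 1))
      - q.toC⁻¹ * (-q.toC * (q.toC ^ n * (q.toC ^ n * f (k + 1 - 1, n)))) = f (k, n)
    have h : wt q n * (wt q (n - 1 + 1) * f (k, n - 1 + 1)) = (1 - q.toC ^ (2 * n)) * f (k, n) := by
      cases n with
      | zero => simp [wt_zero]
      | succ n => rw [Nat.add_sub_cancel, ← mul_assoc, wt_sq]
    rw [h, add_sub_cancel_right]
    field_simp
    ring

/-- The `*`-representation of the coordinate algebra on `ℓ²(ℤ × ℕ)` with
`a e_{k,n} = √(1 - q^{2n}) e_{k,n-1}` and `c e_{k,n} = q^n e_{k+1,n}`. -/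
def rep (q : QParam) : QSU2 q →ₐ[ℂ] (L2 →L[ℂ] L2) := lift (op_rel q)

open ContinuousLinearMap in
lemma rep_star (q : QParam) (x : QSU2 q) : rep q (star x) = adjoint (rep q x) := by
  have hq := q.toC_ne_zero
  have ha : rep q (gen q .a) = opA q := lift_gen _ _
  have hb : rep q (gen q .b) = -q.toC • opCStar q := lift_gen _ _
  have hc : rep q (gen q .c) = opC q := lift_gen _ _
  have hd : rep q (gen q .d) = opAStar q := lift_gen _ _
  have hs : starRingEnd ℂ (-q.toC) = -q.toC := by
    rw [map_neg]; exact congrArg _ q.star_toC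
  induction x using QSU2.induction with
  | scalar z =>
    rw [star_algebraMap', AlgHom.commutes, AlgHom.commutes, ← star_eq_adjoint, ← algebraMap_star_comm]
  | gens g =>
    cases g
    · rw [star_a, ha, hd, adjoint_opA]
    · rw [star_b, map_smul, hb, hc, map_smulₛₗ, hs, ← adjoint_opC, adjoint_adjoint]
    · rw [star_c, map_smul, hb, hc, adjoint_opC, smul_smul]; simp [hq]
    · rw [star_d, ha, hd, ← adjoint_opA, adjoint_adjoint]
  | mul x y hx hy =>
    rw [star_mul', map_mul, map_mul, hx, hy, ← star_eq_adjoint, ← star_eq_adjoint,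
      ← star_eq_adjoint, star_mul]
  | add x y hx hy => rw [star_add', map_add, map_add, hx, hy, map_add]

end QSU2

namespace QSU2

open ContinuousLinearMap

/-- The diagonal matrix coefficient `⟨e_{0,n}, π(f) e_{0,n}⟩`. -/
def diagCoeff (q : QParam) (n : ℕ) (f : QSU2 q) : ℂ := inner ℂ (e 0 n) (rep q f (e 0 n))

lemma norm_e (k : ℤ) (n : ℕ) : ‖e k n‖ = 1 := by
  simp [e, lp.norm_single]

lemma q_sq_lt_one (q : QParam) : (q : ℝ) ^ 2 < 1 :=
  pow_lt_one₀ q.pos.le q.lt_one two_ne_zero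

lemma summable_q (q : QParam) (C : ℝ) : Summable fun n : ℕ => (q : ℝ) ^ (2 * n) * C := by
  simp only [pow_mul]
  exact (summable_geometric_of_lt_one (sq_nonneg _) (q_sq_lt_one q)).mul_right C

lemma summable_diagCoeff (q : QParam) (f : QSU2 q) :
    Summable fun n : ℕ => q.toC ^ (2 * n) * diagCoeff q n f := by
  refine Summable.of_norm_bounded (summable_q q ‖rep q f‖) fun n => ?_
  rw [norm_mul, norm_pow, QParam.toC, Complex.norm_real, Real.norm_of_nonneg q.pos.le]
  refine mul_le_mul_of_nonneg_left ?_ (pow_nonneg q.pos.le _)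
  refine (norm_inner_le_norm _ _).trans ?_
  rw [norm_e, one_mul]
  simpa [norm_e] using (rep q f).le_opNorm (e 0 n)

/-- The Haar state of `SU_q(2)`, given by Woronowicz's formula
`h(f) = (1 - q²) ∑_{n ≥ 0} q^{2n} ⟨e_{0,n}, π(f) e_{0,n}⟩`. -/
def haar (q : QParam) : QSU2 q →ₗ[ℂ] ℂ where
  toFun f := (1 - q.toC ^ 2) * ∑' n : ℕ, q.toC ^ (2 * n) * diagCoeff q n f
  map_add' f g := by
    rw [← mul_add, ← (summable_diagCoeff q f).tsum_add (summable_diagCoeff q g)]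
    simp [diagCoeff, mul_add]
  map_smul' z f := by
    have h : ∀ n, q.toC ^ (2 * n) * diagCoeff q n (z • f) =
        z * (q.toC ^ (2 * n) * diagCoeff q n f) := fun n => by
      simp [diagCoeff, mul_left_comm]
    rw [RingHom.id_apply, smul_eq_mul, tsum_congr h, tsum_mul_left, mul_left_comm]

lemma haar_apply (q : QParam) (f : QSU2 q) :
    haar q f = (1 - q.toC ^ 2) * ∑' n : ℕ, q.toC ^ (2 * n) * diagCoeff q n f := rfl

lemma haar_one (q : QParam) : haar q 1 = 1 := by
  have h : ∀ n, diagCoeff q n (1 : QSU2 q) = 1 := fun n => by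
    simp [diagCoeff, norm_e]
  have h2 : ‖q.toC ^ 2‖ < 1 := by
    rw [norm_pow, QParam.toC, Complex.norm_real, Real.norm_of_nonneg q.pos.le]
    exact q_sq_lt_one q
  have h3 : 1 - q.toC ^ 2 ≠ 0 := by
    intro h0
    rw [← sub_eq_zero.1 h0] at h2
    simp at h2
  simp only [haar_apply, h, mul_one, pow_mul]
  rw [tsum_geometric_of_norm_lt_one h2, mul_inv_cancel₀ h3]

lemma haar_star (q : QParam) (f : QSU2 q) : haar q (star f) = star (haar q f) := by
  have h : ∀ n, diagCoeff q n (star f) = star (diagCoeff q n f) := fun n => by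
    rw [diagCoeff, rep_star, adjoint_inner_right, diagCoeff]
    exact (inner_conj_symm _ _).symm
  rw [haar_apply, haar_apply, StarMul.star_mul, tsum_star, star_sub, star_pow, q.star_toC,
    star_one, mul_comm]
  simp only [h, StarMul.star_mul, star_pow, q.star_toC, mul_comm]

/-- `h(f f*) = (1 - q²) ∑ q^{2n} ‖π(f)* e_{0,n}‖²`. -/
lemma haar_mul_star (q : QParam) (f : QSU2 q) :
    haar q (f * star f) = (((1 - (q : ℝ) ^ 2) *
      ∑' n : ℕ, (q : ℝ) ^ (2 * n) * ‖adjoint (rep q f) (e 0 n)‖ ^ 2 : ℝ) : ℂ) := by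
  have h : ∀ n, diagCoeff q n (f * star f) = ((‖adjoint (rep q f) (e 0 n)‖ ^ 2 : ℝ) : ℂ) := by
    intro n
    rw [diagCoeff, map_mul, rep_star, mul_apply_eq_comp, ← adjoint_inner_left]
    simp [inner_self_eq_norm_sq_to_K]
  simp only [haar_apply, h]
  push_cast
  rfl

/-- The positive semidefinite inner product `⟨y, x⟩ = h(x y*)`. -/
@[reducible] def preInner (q : QParam) : PreInnerProductSpace.Core ℂ (QSU2 q) where
  inner y x := haar q (x * star y)
  conj_inner_symm x y := by
    change star (haar q (x * star y)) = haar q (y * star x)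
    rw [← haar_star, StarMul.star_mul, star_star]
  re_inner_nonneg x := by
    rw [haar_mul_star]
    simp only [RCLike.re_to_complex, Complex.ofReal_re]
    exact mul_nonneg (sub_nonneg.2 (q_sq_lt_one q).le)
      (tsum_nonneg fun n => mul_nonneg (pow_nonneg q.pos.le _) (sq_nonneg _))
  add_left x y z := by
    change haar q (z * star (x + y)) = haar q (z * star x) + haar q (z * star y)
    rw [star_add, mul_add, map_add]
  smul_left x y z := by
    change haar q (y * star (z • x)) = star z * haar q (y * star x)
    rw [star_smul, mul_smul_comm, map_smul, smul_eq_mul]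

instance (q : QParam) : SeminormedAddCommGroup (QSU2 q) :=
  @InnerProductSpace.Core.toSeminormedAddCommGroup ℂ (QSU2 q) _ _ _ (preInner q)

instance (q : QParam) : InnerProductSpace ℂ (QSU2 q) := InnerProductSpace.ofCore (preInner q)

lemma inner_eq (q : QParam) (x y : QSU2 q) : inner ℂ y x = haar q (x * star y) := rfl

lemma norm_sq_eq (q : QParam) (f : QSU2 q) : ((‖f‖ ^ 2 : ℝ) : ℂ) = haar q (f * star f) := by
  rw [← inner_eq, inner_self_eq_norm_sq_to_K]
  simp

lemma norm_mul_le' (q : QParam) (f t : QSU2 q) : ‖f * t‖ ≤ ‖rep q t‖ * ‖f‖ := by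
  have key : ∀ g : QSU2 q, ‖g‖ ^ 2 = (1 - (q : ℝ) ^ 2) *
      ∑' n : ℕ, (q : ℝ) ^ (2 * n) * ‖adjoint (rep q g) (e 0 n)‖ ^ 2 := fun g =>
    Complex.ofReal_injective ((norm_sq_eq q g).trans (haar_mul_star q g))
  have hs : ∀ g : QSU2 q, Summable fun n : ℕ =>
      (q : ℝ) ^ (2 * n) * ‖adjoint (rep q g) (e 0 n)‖ ^ 2 := fun g => by
    refine Summable.of_nonneg_of_le (fun n => mul_nonneg (pow_nonneg q.pos.le _) (sq_nonneg _))
      (fun n => ?_) (summable_q q (‖adjoint (rep q g)‖ ^ 2))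
    have := (adjoint (rep q g)).le_opNorm (e 0 n)
    rw [norm_e, mul_one] at this
    have h0 := pow_nonneg q.pos.le (2 * n)
    gcongr
  refine abs_le_of_sq_le_sq' ?_ (by positivity) |>.2
  rw [mul_pow, key, key, mul_left_comm, ← tsum_mul_left (a := ‖rep q t‖ ^ 2)]
  refine mul_le_mul_of_nonneg_left ?_ (sub_nonneg.2 (q_sq_lt_one q).le)
  refine (hs _).tsum_le_tsum (fun n => ?_) ((hs f).mul_left _)
  rw [mul_left_comm, ← mul_pow]
  have h0 := pow_nonneg q.pos.le (2 * n)
  have h1 : adjoint (rep q (f * t)) (e 0 n) = adjoint (rep q t) (adjoint (rep q f) (e 0 n)) := by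
    rw [← rep_star, ← rep_star, ← rep_star, StarMul.star_mul, map_mul]
    rfl
  have h2 := (adjoint (rep q t)).le_opNorm (adjoint (rep q f) (e 0 n))
  rw [LinearIsometryEquiv.norm_map] at h2
  rw [h1]
  gcongr

/-- The Hilbert space `L²(SU_q(2))`: the completion of the coordinate algebra for the norm
`‖f‖² = h(f f*)`. -/
abbrev Hilb (q : QParam) : Type := UniformSpace.Completion (QSU2 q)

/-- Right multiplication by `t` on the coordinate algebra, as a continuous linear map. -/
def rmul₀ {q : QParam} (t : QSU2 q) : QSU2 q →L[ℂ] QSU2 q :=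
  LinearMap.mkContinuous (LinearMap.mulRight ℂ t) ‖rep q t‖ fun f => norm_mul_le' q f t

/-- Right multiplication by an element `t` of the coordinate algebra, extended by continuity to
`L²(SU_q(2))`. -/
def rmul {q : QParam} (t : QSU2 q) : Hilb q →L[ℂ] Hilb q :=
  ((UniformSpace.Completion.toComplL (𝕜 := ℂ) (E := QSU2 q)).comp (rmul₀ t)).extend
    (UniformSpace.Completion.toComplL (𝕜 := ℂ) (E := QSU2 q))

lemma rmul_coe {q : QParam} (f t : QSU2 q) : rmul t (f : Hilb q) = ((f * t : QSU2 q) : Hilb q) := by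
  rw [rmul]
  exact extend_eq _ (UniformSpace.Completion.denseRange_coe)
    (UniformSpace.Completion.isUniformInducing_coe _) f

end QSU2

/-! ### The quantum plane and the matrix corepresentations -/

/-- The relation `x y = q y x`; the generators are `x = ι 0` and `y = ι 1`. -/
inductive QPlaneRel (q : QParam) : FreeAlgebra ℂ (Fin 2) → FreeAlgebra ℂ (Fin 2) → Prop
  | xy : QPlaneRel q (.ι ℂ 0 * .ι ℂ 1) (q.toC • (.ι ℂ 1 * .ι ℂ 0))

/-- The quantum plane: the complex algebra generated by `x, y` with the relation `x y = q y x`. -/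
def QPlane (q : QParam) : Type := RingQuot (QPlaneRel q)

namespace QPlane

instance (q : QParam) : Ring (QPlane q) := inferInstanceAs (Ring (RingQuot (QPlaneRel q)))

instance (q : QParam) : Algebra ℂ (QPlane q) :=
  inferInstanceAs (Algebra ℂ (RingQuot (QPlaneRel q)))

/-- The projection from the free algebra. -/
def mk (q : QParam) : FreeAlgebra ℂ (Fin 2) →ₐ[ℂ] QPlane q := RingQuot.mkAlgHom ℂ (QPlaneRel q)

/-- The coordinate `x`. -/
def x (q : QParam) : QPlane q := mk q (.ι ℂ 0)

/-- The coordinate `y`. -/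
def y (q : QParam) : QPlane q := mk q (.ι ℂ 1)

lemma x_mul_y (q : QParam) : x q * y q = q.toC • (y q * x q) := by
  have h : mk q (.ι ℂ 0 * .ι ℂ 1) = mk q (q.toC • (.ι ℂ 1 * .ι ℂ 0)) :=
    RingQuot.mkAlgHom_rel ℂ .xy
  simpa [x, y] using h

/-- The universal property of the quantum plane. -/
def lift {q : QParam} {B : Type*} [Ring B] [Algebra ℂ B] (u v : B)
    (h : u * v = q.toC • (v * u)) : QPlane q →ₐ[ℂ] B :=
  RingQuot.liftAlgHom ℂ ⟨FreeAlgebra.lift ℂ ![u, v], by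
    intro x y hxy
    cases hxy
    simp [h]⟩

lemma lift_x {q : QParam} {B : Type*} [Ring B] [Algebra ℂ B] (u v : B)
    (h : u * v = q.toC • (v * u)) : lift u v h (x q) = u :=
  (RingQuot.liftAlgHom_mkAlgHom_apply ℂ _ _ _).trans (FreeAlgebra.lift_ι_apply _ _)

lemma lift_y {q : QParam} {B : Type*} [Ring B] [Algebra ℂ B] (u v : B)
    (h : u * v = q.toC • (v * u)) : lift u v h (y q) = v :=
  (RingQuot.liftAlgHom_mkAlgHom_apply ℂ _ _ _).trans (FreeAlgebra.lift_ι_apply _ _)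

/-- The ordered monomials `x^i y^j`. -/
def monomial (q : QParam) (p : ℕ × ℕ) : QPlane q := x q ^ p.1 * y q ^ p.2

/-- The operator `e_{i,j} ↦ e_{i+1,j}`. -/
def modelX : Module.End ℂ (ℕ × ℕ →₀ ℂ) := Finsupp.lmapDomain ℂ ℂ fun p => (p.1 + 1, p.2)

/-- The operator `e_{i,j} ↦ q^{-i} e_{i,j+1}`. -/
def modelY (q : QParam) : Module.End ℂ (ℕ × ℕ →₀ ℂ) :=
  Finsupp.lsum ℂ fun p => (q.toC⁻¹ ^ p.1) • Finsupp.lsingle (p.1, p.2 + 1)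

lemma modelX_single (i j : ℕ) (z : ℂ) :
    modelX (Finsupp.single (i, j) z) = Finsupp.single (i + 1, j) z := by
  simp [modelX]

lemma modelY_single (q : QParam) (i j : ℕ) (z : ℂ) :
    modelY q (Finsupp.single (i, j) z) = Finsupp.single (i, j + 1) (q.toC⁻¹ ^ i * z) := by
  simp [modelY]

lemma model_rel (q : QParam) : modelX * modelY q = q.toC • (modelY q * modelX) := by
  have hq := q.toC_ne_zero
  refine Finsupp.lhom_ext fun p z => ?_
  obtain ⟨i, j⟩ := p
  simp only [Module.End.mul_apply, LinearMap.smul_apply, modelX_single, modelY_single,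
    Finsupp.smul_single, smul_eq_mul]
  congr 1
  rw [pow_succ]
  field_simp

/-- Left multiplication on the quantum plane in the monomial basis. -/
def model (q : QParam) : QPlane q →ₐ[ℂ] Module.End ℂ (ℕ × ℕ →₀ ℂ) :=
  lift modelX (modelY q) (model_rel q)

lemma model_monomial (q : QParam) (p : ℕ × ℕ) :
    model q (monomial q p) (Finsupp.single (0, 0) 1) = Finsupp.single p 1 := by
  obtain ⟨i, j⟩ := p
  have hy : ∀ j : ℕ, (modelY q ^ j) (Finsupp.single (0, 0) 1) = Finsupp.single (0, j) 1 := by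
    intro j
    induction j with
    | zero => simp
    | succ j ih => rw [pow_succ', Module.End.mul_apply, ih, modelY_single]; simp
  have hx : ∀ i : ℕ, (modelX ^ i) (Finsupp.single (0, j) (1 : ℂ)) = Finsupp.single (i, j) 1 := by
    intro i
    induction i with
    | zero => simp
    | succ i ih => rw [pow_succ', Module.End.mul_apply, ih, modelX_single]
  simp [monomial, model, lift_x, lift_y, hy, hx]

lemma linearIndependent_monomial (q : QParam) : LinearIndependent ℂ (monomial q) := by
  refine LinearIndependent.of_comp
    ((LinearMap.applyₗ (Finsupp.single (0, 0) (1 : ℂ))).comp (model q).toLinearMap) ?_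
  have : (((LinearMap.applyₗ (Finsupp.single (0, 0) (1 : ℂ))).comp (model q).toLinearMap) ∘
      monomial q) = fun p => Finsupp.single p (1 : ℂ) := funext fun p => model_monomial q p
  rw [this]
  simpa using (Finsupp.basisSingleOne (R := ℂ) (ι := ℕ × ℕ)).linearIndependent

lemma y_mul_pow (q : QParam) (i : ℕ) : y q * x q ^ i = q.toC⁻¹ ^ i • (x q ^ i * y q) := by
  have h : y q * x q = q.toC⁻¹ • (x q * y q) := by
    rw [x_mul_y, smul_smul, inv_mul_cancel₀ q.toC_ne_zero, one_smul]
  induction i with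
  | zero => simp
  | succ i ih =>
    rw [pow_succ, ← mul_assoc, ih, smul_mul_assoc, mul_assoc, h, mul_smul_comm, smul_smul,
      ← mul_assoc, pow_succ]

lemma span_monomial (q : QParam) : ⊤ ≤ Submodule.span ℂ (Set.range (monomial q)) := by
  set S := Submodule.span ℂ (Set.range (monomial q)) with hS
  have hx : ∀ s ∈ S, x q * s ∈ S := by
    intro s hs
    have : S ≤ S.comap (LinearMap.mulLeft ℂ (x q)) := by
      rw [hS, Submodule.span_le]
      rintro _ ⟨⟨i, j⟩, rfl⟩
      refine Submodule.subset_span ⟨(i + 1, j), ?_⟩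
      simp [monomial, pow_succ', mul_assoc]
    exact this hs
  have hy : ∀ s ∈ S, y q * s ∈ S := by
    intro s hs
    have : S ≤ S.comap (LinearMap.mulLeft ℂ (y q)) := by
      rw [hS, Submodule.span_le]
      rintro _ ⟨⟨i, j⟩, rfl⟩
      have : y q * monomial q (i, j) = q.toC⁻¹ ^ i • monomial q (i, j + 1) := by
        rw [monomial, ← mul_assoc, y_mul_pow, smul_mul_assoc, mul_assoc, ← pow_succ']
        rfl
      change y q * monomial q (i, j) ∈ S
      rw [this]
      exact S.smul_mem _ (Submodule.subset_span ⟨_, rfl⟩)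
    exact this hs
  have key : ∀ p : FreeAlgebra ℂ (Fin 2), ∀ s ∈ S, mk q p * s ∈ S := by
    intro p
    induction p with
    | grade0 z =>
      intro s hs
      rw [AlgHom.commutes, ← Algebra.smul_def]
      exact S.smul_mem _ hs
    | grade1 g =>
      fin_cases g
      · exact hx
      · exact hy
    | mul a b ha hb =>
      intro s hs
      rw [map_mul, mul_assoc]
      exact ha _ (hb _ hs)
    | add a b ha hb =>
      intro s hs
      rw [map_add, add_mul]
      exact S.add_mem (ha _ hs) (hb _ hs)
  intro p _
  obtain ⟨p, rfl⟩ := RingQuot.mkAlgHom_surjective ℂ (QPlaneRel q) p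
  have h1 : (1 : QPlane q) ∈ S := Submodule.subset_span ⟨(0, 0), by simp [monomial]⟩
  exact mul_one (mk q p) ▸ key p 1 h1

/-- The basis of ordered monomials `x^i y^j` of the quantum plane. -/
def basis (q : QParam) : Module.Basis (ℕ × ℕ) ℂ (QPlane q) :=
  Module.Basis.mk (linearIndependent_monomial q) (span_monomial q)

lemma coaction_rel (q : QParam) :
    (x q ⊗ₜ[ℂ] QSU2.gen q .a + y q ⊗ₜ[ℂ] QSU2.gen q .c) *
        (x q ⊗ₜ[ℂ] QSU2.gen q .b + y q ⊗ₜ[ℂ] QSU2.gen q .d) =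
      q.toC • ((x q ⊗ₜ[ℂ] QSU2.gen q .b + y q ⊗ₜ[ℂ] QSU2.gen q .d) *
        (x q ⊗ₜ[ℂ] QSU2.gen q .a + y q ⊗ₜ[ℂ] QSU2.gen q .c)) := by
  have h := QSU2.gen_rel q
  have had : QSU2.gen q .a * QSU2.gen q .d = 1 + q.toC • (QSU2.gen q .b * QSU2.gen q .c) :=
    sub_eq_iff_eq_add.1 h.ad
  have hda : QSU2.gen q .d * QSU2.gen q .a = 1 + q.toC⁻¹ • (QSU2.gen q .b * QSU2.gen q .c) :=
    sub_eq_iff_eq_add.1 h.da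
  simp only [add_mul, mul_add, Algebra.TensorProduct.tmul_mul_tmul, h.ab, h.cd, ← h.bc, had, hda,
    x_mul_y, TensorProduct.tmul_add, TensorProduct.tmul_smul, TensorProduct.smul_tmul', smul_add,
    smul_smul, mul_inv_cancel₀ q.toC_ne_zero, one_smul]
  abel

/-- The right coaction of `SU_q(2)` on the quantum plane: the algebra homomorphism with
`R(x) = x ⊗ a + y ⊗ c` and `R(y) = x ⊗ b + y ⊗ d`. -/
def coaction (q : QParam) : QPlane q →ₐ[ℂ] QPlane q ⊗[ℂ] QSU2 q :=
  lift (x q ⊗ₜ[ℂ] QSU2.gen q .a + y q ⊗ₜ[ℂ] QSU2.gen q .c)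
    (x q ⊗ₜ[ℂ] QSU2.gen q .b + y q ⊗ₜ[ℂ] QSU2.gen q .d) (coaction_rel q)

/-- The Gaussian integer `1 + p + ⋯ + p^{n-1}`. -/
def gaussNat (p : ℝ) (n : ℕ) : ℝ := ∑ i ∈ Finset.range n, p ^ i

/-- The Gaussian factorial. -/
def gaussFactorial (p : ℝ) (n : ℕ) : ℝ := ∏ i ∈ Finset.range n, gaussNat p (i + 1)

/-- The Gaussian binomial coefficient, for `s ≤ k`. -/
def gaussBinom (p : ℝ) (k s : ℕ) : ℝ :=
  gaussFactorial p k / (gaussFactorial p s * gaussFactorial p (k - s))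

/-- The normalization factor of the vector `N_s x^{k-s} y^s` of the orthonormal basis of the
homogeneous polynomials of degree `k`, the square root of a Gaussian binomial coefficient in base
`q^{-2}`. -/
def normFactor (q : QParam) (k s : ℕ) : ℝ := √(gaussBinom ((q : ℝ) ^ 2)⁻¹ k s)

end QPlane

namespace QSU2

/-- The matrix coefficient `t^l_{rs}` of the irreducible corepresentation `T^l` with `k = 2l`. The
corepresentation is the restriction of the coaction to the homogeneous polynomials of degree `k` in
the basis `f_s = N_s x^{k-s} y^s`, `0 ≤ s ≤ k`, so that `R(f_s) = ∑_r f_r ⊗ t_{rs}`. The index `r`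
stands for the half-integer `r - l`. -/
def t (q : QParam) (k : ℕ) : Matrix (Fin (k + 1)) (Fin (k + 1)) (QSU2 q) := fun r s =>
  ((QPlane.normFactor q k s / QPlane.normFactor q k r : ℝ) : ℂ) •
    TensorProduct.equivFinsuppOfBasisLeft (QPlane.basis q)
      (QPlane.coaction q (QPlane.monomial q (k - s, s))) (k - r, r)

end QSU2

/-! ### Fourier transform, symbols and global pseudo-differential operators

Half-integers `l` are encoded by the natural number `k = 2l`, and a matrix index `i : Fin (k + 1)`
stands for the half-integer `i - l`. -/

namespace QSU2

/-- The `q`-number `[n]_q = (q^n - q^{-n}) / (q - q⁻¹)`. -/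
def qNum (q : QParam) (n : ℕ) : ℝ :=
  ((q : ℝ) ^ n - ((q : ℝ) ^ n)⁻¹) / ((q : ℝ) - (q : ℝ)⁻¹)

/-- The Fourier transform `f̂(l)_{mn} = h(f (t^l_{nm})*) = ⟨t^l_{nm}, f⟩`, with `k = 2l`. -/
def fourier {q : QParam} (f : Hilb q) (k : ℕ) : Matrix (Fin (k + 1)) (Fin (k + 1)) ℂ :=
  fun m n => inner ℂ (t q k n m : Hilb q) f

lemma fourier_coe {q : QParam} (f : QSU2 q) (k : ℕ) (m n : Fin (k + 1)) :
    fourier (f : Hilb q) k m n = haar q (f * star (t q k n m)) := by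
  rw [fourier, UniformSpace.Completion.inner_coe, inner_eq]

/-- A symbol: for every half-integer `l` a `(2l+1) × (2l+1)` matrix with entries in the completion
`L²(SU_q(2))`. -/
abbrev Symbol (q : QParam) : Type := ∀ k : ℕ, Matrix (Fin (k + 1)) (Fin (k + 1)) (Hilb q)

/-- The summand `[2l+1]_q Tr(σ(l) f̂(l) T^l)`, with `k = 2l`, of the series defining `T_σ f`. -/
def symbolTerm {q : QParam} (σ : Symbol q) (f : Hilb q) (k : ℕ) : Hilb q :=
  (qNum q (k + 1) : ℂ) •
    ∑ i, ∑ j, ∑ p, fourier f k j p • rmul (t q k p i) (σ k i j)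

lemma symbolTerm_add {q : QParam} (σ : Symbol q) (f g : Hilb q) :
    symbolTerm σ (f + g) = fun k => symbolTerm σ f k + symbolTerm σ g k := by
  funext k
  simp only [symbolTerm, fourier, inner_add_right, add_smul, Finset.sum_add_distrib, smul_add]

lemma symbolTerm_smul {q : QParam} (σ : Symbol q) (z : ℂ) (f : Hilb q) :
    symbolTerm σ (z • f) = fun k => z • symbolTerm σ f k := by
  funext k
  simp only [symbolTerm, fourier, inner_smul_right, Finset.smul_sum, smul_smul, mul_left_comm]

/-- The global pseudo-differential operator `T_σ f = ∑_l [2l+1]_q Tr(σ(l) f̂(l) T^l)`, defined for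
those `f` in `L²(SU_q(2))` for which the partial sums of the series converge in norm. -/
def pdo {q : QParam} (σ : Symbol q) : Hilb q →ₗ.[ℂ] Hilb q where
  domain :=
    { carrier := {f | Summable (symbolTerm σ f) (.conditional ℕ)}
      add_mem' := fun {f g} hf hg => by
        rw [Set.mem_ofPred_eq, symbolTerm_add]
        exact Summable.add hf hg
      zero_mem' := by
        have h : symbolTerm σ (0 : Hilb q) = fun _ => 0 := by
          funext k
          simp [symbolTerm, fourier]
        rw [Set.mem_ofPred_eq, h]
        exact summable_zero
      smul_mem' := fun z f hf => by
        rw [Set.mem_ofPred_eq, symbolTerm_smul]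
        exact Summable.const_smul z hf }
  toFun :=
    { toFun := fun f => ∑'[.conditional ℕ] k, symbolTerm σ f k
      map_add' := fun f g => by
        rw [Submodule.coe_add, symbolTerm_add]
        exact Summable.tsum_add f.2 g.2
      map_smul' := fun z f => by
        rw [Submodule.coe_smul, symbolTerm_smul]
        exact Summable.tsum_const_smul z f.2 }

/-- Twice the half-integer `i - l` which the index `i : Fin (k + 1)` stands for, where `k = 2l`. -/
def twiceIndex {k : ℕ} (i : Fin (k + 1)) : ℤ := 2 * (i : ℤ) - k

/-- Homogeneous symbols of Fourier order `m = M / 2 ≥ 0`: for every `l` there is an index map `ψ(l)`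
such that `σ(l)_{ij}` is a multiple of `t^m_{ψ(l)(i,j)}`, and `σ(l)_{ij} = 0` if `ψ(l)(i,j)` is not
a pair of indices of `T^m`. The values of `ψ` are pairs of half-integers, encoded by their
doubles. -/
def IsHomogeneous {q : QParam} (M : ℕ) (σ : Symbol q) : Prop :=
  ∀ k : ℕ, ∃ ψ : Fin (k + 1) × Fin (k + 1) → ℤ × ℤ, ∀ i j : Fin (k + 1),
    (∀ r s : Fin (M + 1), ψ (i, j) = (twiceIndex r, twiceIndex s) →
      σ k i j ∈ Submodule.span ℂ {(t q M r s : Hilb q)}) ∧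
    ((¬ ∃ r s : Fin (M + 1), ψ (i, j) = (twiceIndex r, twiceIndex s)) → σ k i j = 0)

/-- `B ∘ A = Id` on the coordinate algebra, all the expressions involved being defined. -/
def CompEqId {q : QParam} (B A : Hilb q →ₗ.[ℂ] Hilb q) : Prop :=
  ∀ f : QSU2 q, ∃ (h : (f : Hilb q) ∈ A.domain) (h' : A ⟨f, h⟩ ∈ B.domain), B ⟨A ⟨f, h⟩, h'⟩ = f

/-- Homogeneous symbols of negative Fourier order `-M / 2`: the operator is inverse to the operator
of a homogeneous symbol of order `M / 2`. -/
def IsHomogeneousNeg {q : QParam} (M : ℕ) (σ : Symbol q) : Prop :=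
  ∃ β : Symbol q, IsHomogeneous M β ∧ CompEqId (pdo β) (pdo σ) ∧ CompEqId (pdo σ) (pdo β)

/-- The class `Φ^{M/2}(SU_q(2))` of symbols of Fourier order `M / 2`, for an integer `M`: the finite
linear combinations of homogeneous symbols of that order. -/
def symbolClass (q : QParam) : ℤ → Submodule ℂ (Symbol q)
  | .ofNat M => Submodule.span ℂ {σ | IsHomogeneous M σ}
  | .negSucc M => Submodule.span ℂ {σ | IsHomogeneousNeg (M + 1) σ}

end QSU2

end

/-! ### Single summands of the series as bounded finite-rank operators -/

namespace QSU2

/-! For a fixed `l`, the summand of the series depends on `f` only through the finitely many Fourier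
coefficients of `f` at `l`. Each coefficient is a bounded functional, being the inner product with a
fixed vector. It multiplies a fixed vector of `L²(SU_q(2))`: the entry `σ(l)_{ij}` multiplied on the
right by a matrix coefficient, which makes sense for any entry of the completion because right
multiplication extends continuously. Hence each summand is a finite sum of bounded rank-one
operators.

When `σ(l)` vanishes for large `l`, only finitely many summands survive. The partial sums are then
eventually constant for every `f`, so no convergence question remains: the domain is the whole
space, and the operator is a finite sum of bounded operators of finite rank. `symbolTermCLM` and
`symbolTerm_mem_span` record boundedness and finite rank of one summand, and `hasSum_symbolTerm`
identifies the series with the finite sum. -/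

/-- The summand `f ↦ [2l+1]_q Tr(σ(l) f̂(l) T^l)` of `T_σ`, with `k = 2l`, as a bounded operator on
`L²(SU_q(2))`. -/
noncomputable def symbolTermCLM {q : QParam} (σ : Symbol q) (k : ℕ) : Hilb q →L[ℂ] Hilb q :=
  (qNum q (k + 1) : ℂ) • ∑ i, ∑ j, ∑ p,
    -- The indices appear as `p j` because the entry `(j, p)` of the Fourier transform pairs `f`
    -- with `t^l_{pj}`, in transposed order.
    (innerSL ℂ (t q k p j : Hilb q)).smulRight (rmul (t q k p i) (σ k i j))

/-- Pairing with `t^l_{pj}` is the Fourier coefficient by definition, so both sides are the same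
triple sum. This is how continuity in `f` reaches the summands of the series. -/
lemma symbolTermCLM_apply {q : QParam} (σ : Symbol q) (f : Hilb q) (k : ℕ) :
    symbolTermCLM σ k f = symbolTerm σ f k := by
  simp [symbolTermCLM, symbolTerm, fourier]

/-- The values of the `k`-th summand of `T_σ` lie in the span of the finitely many vectors
`σ(l)_{ij} t^l_{pi}`. -/
lemma symbolTerm_mem_span {q : QParam} (σ : Symbol q) (f : Hilb q) (k : ℕ) :
    symbolTerm σ f k ∈ Submodule.span ℂ
      (Set.range fun x : Fin (k + 1) × Fin (k + 1) × Fin (k + 1) =>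
        rmul (t q k x.2.2 x.1) (σ k x.1 x.2.1)) :=
  Submodule.smul_mem _ _ <| Submodule.sum_mem _ fun i _ => Submodule.sum_mem _ fun j _ =>
    Submodule.sum_mem _ fun p _ =>
      Submodule.smul_mem _ _ (Submodule.subset_span ⟨(i, j, p), rfl⟩)

/-! ### Symbols supported on finitely many `l` -/

lemma symbolTerm_eq_zero {q : QParam} {σ : Symbol q} {k : ℕ} (h : σ k = 0) (f : Hilb q) :
    symbolTerm σ f k = 0 := by
  simp [symbolTerm, h]

/-- If `σ(l)` vanishes outside a finite set of `l`, the series defining `T_σ f` is a finite sum for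
every `f`. -/
lemma hasSum_symbolTerm {q : QParam} {σ : Symbol q} {s : Finset ℕ} (h : ∀ k ∉ s, σ k = 0)
    (f : Hilb q) :
    HasSum (symbolTerm σ f) ((∑ k ∈ s, symbolTermCLM σ k) f) (.conditional ℕ) := by
  simp only [sum_apply, symbolTermCLM_apply]
  -- The partial sums along `ℕ` eventually contain all of `s`; from then on they no longer change,
  -- since terms outside `s` are zero.
  exact hasSum_sum_of_ne_finset_zero fun k hk => symbolTerm_eq_zero (h k hk) f

/-- Membership in the domain is by definition summability along `ℕ`, and a series with finitely many
nonzero terms is summable whatever `f` is. -/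
lemma pdo_domain_eq_top {q : QParam} {σ : Symbol q} {s : Finset ℕ} (h : ∀ k ∉ s, σ k = 0) :
    (pdo σ).domain = ⊤ :=
  eq_top_iff.2 fun f _ => (hasSum_symbolTerm h f).summable

/-- The value of the operator is defined as the conditional sum of the series, and limits in a
Hausdorff space are unique. The right-hand side is a bounded operator on the whole space, so this
equality is the source of both continuity and the bound on the range. -/
lemma pdo_apply_eq_sum {q : QParam} {σ : Symbol q} {s : Finset ℕ} (h : ∀ k ∉ s, σ k = 0)
    (f : (pdo σ).domain) : pdo σ f = (∑ k ∈ s, symbolTermCLM σ k) (f : Hilb q) :=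
  (hasSum_symbolTerm h (f : Hilb q)).tsum_eq

/-- The vectors that span the values of a summand do not depend on `f`. One finite-dimensional
space, the sum over `s` of these spans, therefore contains all values at once. -/
lemma finiteDimensional_range_pdo {q : QParam} {σ : Symbol q} {s : Finset ℕ}
    (h : ∀ k ∉ s, σ k = 0) : FiniteDimensional ℂ (LinearMap.range (pdo σ).toFun) := by
  let V : ℕ → Submodule ℂ (Hilb q) := fun k => Submodule.span ℂ
    (Set.range fun x : Fin (k + 1) × Fin (k + 1) × Fin (k + 1) =>
      rmul (t q k x.2.2 x.1) (σ k x.1 x.2.1))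
  -- Each span has at most `(k + 1) ^ 3` generators. Kept in the context, this serves as the
  -- instance that makes the finite supremum `s.sup V` finite dimensional.
  have hV : ∀ k, FiniteDimensional ℂ (V k) := fun k =>
    FiniteDimensional.span_of_finite ℂ (Set.finite_range _)
  refine Submodule.finiteDimensional_of_le (S₂ := s.sup V) ?_
  rintro _ ⟨f, rfl⟩
  change pdo σ f ∈ _
  rw [pdo_apply_eq_sum h, sum_apply]
  refine Submodule.sum_mem _ fun k hk => ?_
  rw [symbolTermCLM_apply]
  -- The `k`-th summand lies in `V k`, which is contained in the supremum because `k ∈ s`.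
  exact Finset.le_sup (f := V) hk (symbolTerm_mem_span σ f k)

end QSU2

theorem mainTheorem12 (q : QParam) (M : ℤ) (σ : QSU2.Symbol q) (hσ : σ ∈ QSU2.symbolClass q M)
    (N : ℕ) (hN : ∀ k : ℕ, 2 * N < k → σ k = 0) :
    (QSU2.pdo σ).domain = ⊤ ∧
      (Continuous fun f : (QSU2.pdo σ).domain => QSU2.pdo σ f) ∧
      FiniteDimensional ℂ (LinearMap.range (QSU2.pdo σ).toFun) := by
  -- Since `k = 2l`, the condition `l ≤ N` reads `k ≤ 2 * N`; hence the range up to `2 * N + 1`,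
  -- which includes the odd `k` of the proper half-integers.
  have h : ∀ k ∉ Finset.range (2 * N + 1), σ k = 0 := fun k hk =>
    hN k (by rw [Finset.mem_range] at hk; omega)
  refine ⟨QSU2.pdo_domain_eq_top h, ?_, QSU2.finiteDimensional_range_pdo h⟩
  -- On its domain, with the subspace topology, the operator is the restriction of a bounded
  -- operator defined everywhere.
  exact ((∑ k ∈ Finset.range (2 * N + 1), QSU2.symbolTermCLM σ k).continuous.comp
    continuous_subtype_val).congr fun f => (QSU2.pdo_apply_eq_sum h f).symm
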